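/- Let $n\ge 0$, and equip the group $U(2^n)$ of $n$-qubit gates (unitary operators on $(\mathbb C^2)^{\otimes n}$) with its Haar probability measure. A circuit without ancilla on $n$ qubits is a finite sequence of gates, applied in order, each of which is either an arbitrary one-qubit unitary in $U(2)$ acting on one of the $n$ qubits, or an arbitrary two-qubit unitary in $U(4)$ acting on two distinct ones of the $n$ qubits, tensored with the identity on the other qubits; it implements $U$ if the product of its gates is $U$. Then, for almost every $U\in U(2^n)$, every circuit without ancilla that implements $U$ contains at least $$\left\lceil \frac{4^n-3n-1}{9}\right\rceil$$ two-qubit gates (one-qubit gates are not counted). In particular, for almost every three-qubit gate $U\in U(8)$, every such circuit contains at least six two-qubit gates. -/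

import Mathlib

open MeasureTheory

/-- Computational basis labels of `n` qubits: bit strings of length `n`. -/
abbrev QubitBasis (n : ℕ) : Type := Fin n → Fin 2

/-- The `n`-qubit gates: the unitary group `U(2^n)` acting on `(ℂ²)^{⊗ n}`, written in the
computational basis. -/
abbrev QubitUnitary (n : ℕ) : Type := Matrix.unitaryGroup (QubitBasis n) ℂ

instance QubitUnitary.compactSpace (n : ℕ) : CompactSpace (QubitUnitary n) := by
  refine (isCompact_iff_compactSpace
    (s := (unitary (Matrix (QubitBasis n) (QubitBasis n) ℂ) : Set (Matrix (QubitBasis n) (QubitBasis n) ℂ)))).mp ?_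
  have hK : IsCompact (Set.pi Set.univ fun _ : QubitBasis n =>
      Set.pi Set.univ fun _ : QubitBasis n => Metric.closedBall (0 : ℂ) 1) :=
    isCompact_univ_pi fun _ => isCompact_univ_pi fun _ => isCompact_closedBall 0 1
  refine hK.of_isClosed_subset (isClosed_unitary (R := Matrix (QubitBasis n) (QubitBasis n) ℂ)) ?_
  intro U hU i _ j _
  simpa using entry_norm_bound_of_unitary hU i j

noncomputable instance QubitUnitary.measurableSpace (n : ℕ) : MeasurableSpace (QubitUnitary n) :=
  borel (QubitUnitary n)

instance QubitUnitary.borelSpace (n : ℕ) : BorelSpace (QubitUnitary n) := ⟨rfl⟩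

/-- The Haar probability measure on the compact group of `n`-qubit unitaries. -/
noncomputable def qubitHaar (n : ℕ) : Measure (QubitUnitary n) :=
  Measure.haarMeasure ⊤

instance qubitHaar.isHaarMeasure (n : ℕ) : (qubitHaar n).IsHaarMeasure := by
  unfold qubitHaar
  infer_instance

instance qubitHaar.isProbabilityMeasure (n : ℕ) : IsProbabilityMeasure (qubitHaar n) :=
  ⟨by
    have h := Measure.haarMeasure_self (K₀ := (⊤ : TopologicalSpace.PositiveCompacts (QubitUnitary n)))
    simpa [qubitHaar] using h⟩

/-- The one- and two-qubit gates available on a register of exactly `n` qubits (no ancilla).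
Both kinds range over all unitaries, and a two-qubit gate may act on any two distinct qubits. -/
inductive QubitGate (n : ℕ) : Type
  | one (i : Fin n) (u : Matrix.unitaryGroup (Fin 2) ℂ) : QubitGate n
  | two (i j : Fin n) (hij : i ≠ j) (V : Matrix.unitaryGroup (Fin 2 × Fin 2) ℂ) : QubitGate n

/-- The operator on the whole register: the gate on its qubit(s), tensored with the identity on
all the other qubits. -/
noncomputable def QubitGate.toMatrix {n : ℕ} : QubitGate n → Matrix (QubitBasis n) (QubitBasis n) ℂ
  | .one i u => fun x y =>
      if ∀ l, l ≠ i → x l = y l then (u : Matrix (Fin 2) (Fin 2) ℂ) (x i) (y i) else 0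
  | .two i j _ V => fun x y =>
      if ∀ l, l ≠ i → l ≠ j → x l = y l then
        (V : Matrix (Fin 2 × Fin 2) (Fin 2 × Fin 2) ℂ) (x i, x j) (y i, y j)
      else 0

/-- A circuit: the list of its gates in the order in which they are applied. -/
abbrev QubitCircuit (n : ℕ) : Type := List (QubitGate n)

/-- The operator computed by a circuit; the head of the list is applied first, so it is the
rightmost factor of the product. -/
noncomputable def QubitCircuit.toMatrix {n : ℕ} :
    QubitCircuit n → Matrix (QubitBasis n) (QubitBasis n) ℂ
  | [] => 1
  | g :: c => QubitCircuit.toMatrix c * g.toMatrix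

/-- The number of two-qubit gates of a circuit; one-qubit gates are free. -/
def QubitCircuit.twoQubitCount {n : ℕ} : QubitCircuit n → ℕ
  | [] => 0
  | .one _ _ :: c => QubitCircuit.twoQubitCount c
  | .two _ _ _ _ :: c => QubitCircuit.twoQubitCount c + 1

/-- The circuit `c` implements the `n`-qubit gate `U`. -/
def QubitCircuit.Implements {n : ℕ} (c : QubitCircuit n) (U : QubitUnitary n) : Prop :=
  QubitCircuit.toMatrix c = (U : Matrix (QubitBasis n) (QubitBasis n) ℂ)

/-- Implementing `U` without ancilla requires at least `m` two-qubit gates. -/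
def RequiresTwoQubitGates {n : ℕ} (U : QubitUnitary n) (m : ℤ) : Prop :=
  ∀ c : QubitCircuit n, QubitCircuit.Implements c U → m ≤ (QubitCircuit.twoQubitCount c : ℤ)

/-! The proof is a dimension count. `U(4)` has real dimension 16 and the local gates `a ⊗ b` form a
subgroup of dimension 4 + 4 - 1 = 7, the phase being shared, so a two-qubit gate modulo local gates
on its right has 9 parameters (`exists_slice_two_qubit`). Local gates can be pushed through a
circuit: those standing to the left of a two-qubit gate are absorbed into it, and its local part
re-emerges on the right. Hence a circuit with `k` two-qubit gates is a product of `k` slice gates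
and one local unitary (`QubitCircuit.exists_toMatrix_eq`). Local unitaries have 3 parameters per
qubit and one global phase, so these circuits fill a set of dimension at most `9k + 3n + 1`, which
is null in `U(2^n)` when this is below `4^n`.

No quotient manifold is needed: "dimension at most `d`" means being covered by countably many `C¹`
images of `ℝ^d`. The analytic inputs are a local slice, from a surjective derivative
(`exists_countablyParametrized_slice`), and nullity of low-dimensional images, from Hausdorff
dimension, Fubini and invariance of Haar measure (`measure_coe_preimage_range_eq_zero`). -/

open Topology Module NormedSpace

/-! ### Sets covered by countably many `C¹` images of `ℝ^d` -/

section CountablyParametrized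

variable {F F' : Type*} [NormedAddCommGroup F] [NormedSpace ℝ F]
  [NormedAddCommGroup F'] [NormedSpace ℝ F']

/-- `S` is covered by countably many `C¹` images of `ℝ^d`. -/
def CountablyParametrized (d : ℕ) (S : Set F) : Prop :=
  ∃ P : Set ((Fin d → ℝ) → F), P.Countable ∧ (∀ f ∈ P, ContDiff ℝ 1 f) ∧
    ∀ x ∈ S, ∃ f ∈ P, x ∈ Set.range f

theorem CountablyParametrized.mono {d : ℕ} {S T : Set F} (hT : CountablyParametrized d T)
    (h : S ⊆ T) : CountablyParametrized d S := by
  obtain ⟨P, hP, hc, hs⟩ := hT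
  exact ⟨P, hP, hc, fun x hx => hs x (h hx)⟩

theorem CountablyParametrized.iUnion {ι : Type*} [Countable ι] {d : ℕ} {S : ι → Set F}
    (hS : ∀ i, CountablyParametrized d (S i)) : CountablyParametrized d (⋃ i, S i) := by
  choose P hP hc hs using hS
  refine ⟨⋃ i, P i, Set.countable_iUnion hP, ?_, ?_⟩
  · intro f hf
    obtain ⟨i, hi⟩ := Set.mem_iUnion.1 hf
    exact hc i f hi
  · intro x hx
    obtain ⟨i, hi⟩ := Set.mem_iUnion.1 hx
    obtain ⟨f, hf, hx⟩ := hs i x hi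
    exact ⟨f, Set.mem_iUnion.2 ⟨i, hf⟩, hx⟩

theorem countablyParametrized_singleton (d : ℕ) (x : F) : CountablyParametrized d {x} :=
  ⟨{fun _ => x}, Set.countable_singleton _, by rintro f rfl; exact contDiff_const,
    fun y hy => ⟨_, rfl, 0, hy.symm⟩⟩

theorem CountablyParametrized.image {d : ℕ} {S : Set F} (hS : CountablyParametrized d S)
    {g : F → F'} (hg : ContDiff ℝ 1 g) : CountablyParametrized d (g '' S) := by
  obtain ⟨P, hP, hc, hs⟩ := hS
  refine ⟨(fun f => g ∘ f) '' P, hP.image _, ?_, ?_⟩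
  · rintro _ ⟨f, hf, rfl⟩
    exact hg.comp (hc f hf)
  · rintro _ ⟨x, hx, rfl⟩
    obtain ⟨f, hf, z, rfl⟩ := hs x hx
    exact ⟨_, ⟨f, hf, rfl⟩, z, rfl⟩

theorem CountablyParametrized.prod {d e : ℕ} {S : Set F} {T : Set F'}
    (hS : CountablyParametrized d S) (hT : CountablyParametrized e T) :
    CountablyParametrized (d + e) (S ×ˢ T) := by
  obtain ⟨P, hP, hc, hs⟩ := hS
  obtain ⟨Q, hQ, hc', hs'⟩ := hT
  refine ⟨Set.image2 (fun f g x => (f (fun i => x (Fin.castAdd e i)),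
    g (fun i => x (Fin.natAdd d i)))) P Q, hP.image2 hQ _, ?_, ?_⟩
  · rintro _ ⟨f, hf, g, hg, rfl⟩
    exact ((hc f hf).comp (by fun_prop)).prodMk ((hc' g hg).comp (by fun_prop))
  · rintro ⟨x, y⟩ ⟨hx, hy⟩
    obtain ⟨f, hf, z, rfl⟩ := hs x hx
    obtain ⟨g, hg, w, rfl⟩ := hs' y hy
    exact ⟨_, ⟨f, hf, g, hg, rfl⟩, Fin.append z w, by simp⟩

theorem CountablyParametrized.pi {n d : ℕ} {S : Set F} (hS : CountablyParametrized d S) :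
    CountablyParametrized (n * d) {x : Fin n → F | ∀ i, x i ∈ S} := by
  obtain ⟨P, hP, hc, hs⟩ := hS
  have : Countable P := hP
  refine ⟨Set.range fun (f : Fin n → P) x i => (f i : (Fin d → ℝ) → F)
    (fun j => x (finProdFinEquiv (i, j))), Set.countable_range _, ?_, ?_⟩
  · rintro _ ⟨f, rfl⟩
    exact contDiff_pi.2 fun i => (hc _ (f i).2).comp (by fun_prop)
  · intro x hx
    choose f hf z hz using fun i => hs (x i) (hx i)
    refine ⟨_, ⟨fun i => ⟨f i, hf i⟩, rfl⟩, fun k => z (finProdFinEquiv.symm k).1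
      (finProdFinEquiv.symm k).2, ?_⟩
    ext1 i
    simp [hz]

end CountablyParametrized

/-! ### Unitary group of a C⋆-algebra: exponential chart, slices and null sets -/

section UnitaryGroup

variable {A : Type*} [CStarAlgebra A]

/-- The exponential map from skew-adjoint elements. -/
noncomputable def skewExp (X : skewAdjoint.submodule ℝ A) : A := exp (X : A)

theorem skewExp_mem_unitary (X : skewAdjoint.submodule ℝ A) : skewExp X ∈ unitary A :=
  letI : NormedAlgebra ℚ A := NormedAlgebra.restrictScalars ℚ ℝ A
  exp_mem_unitary_of_mem_skewAdjoint X.2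

theorem contDiff_exp_algebra : ContDiff ℝ 1 (exp : A → A) :=
  contDiff_iff_contDiffAt.2 fun x => (exp_analytic (𝕂 := ℝ) x).contDiffAt

theorem contDiff_skewExp : ContDiff ℝ 1 (skewExp (A := A)) :=
  contDiff_exp_algebra.comp (skewAdjoint.submodule ℝ A).subtypeL.contDiff

theorem skewExp_zero : skewExp (0 : skewAdjoint.submodule ℝ A) = 1 := by
  simp [skewExp]

theorem hasStrictFDerivAt_skewExp :
    HasStrictFDerivAt (skewExp (A := A)) (skewAdjoint.submodule ℝ A).subtypeL 0 := by
  have h : HasStrictFDerivAt (exp : A → A) (1 : A →L[ℝ] A)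
      ((skewAdjoint.submodule ℝ A).subtypeL 0) := by
    simpa using hasStrictFDerivAt_exp_zero (𝕂 := ℝ) (𝔸 := A)
  exact h.comp 0 (skewAdjoint.submodule ℝ A).subtypeL.hasStrictFDerivAt

variable (A) in
/-- The projection to the skew-adjoint part. -/
noncomputable def skewPart [FiniteDimensional ℂ A] : A →L[ℝ] skewAdjoint.submodule ℝ A :=
  have : FiniteDimensional ℝ A := FiniteDimensional.complexToReal A
  LinearMap.toContinuousLinearMap (skewAdjointPart ℝ : A →ₗ[ℝ] skewAdjoint A)

variable [FiniteDimensional ℂ A]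

theorem coe_skewPart (a : A) : (skewPart A a : A) = (2⁻¹ : ℝ) • (a - star a) := by
  have : (skewPart A a : A) = (skewAdjointPart ℝ a : A) := rfl
  rw [this, skewAdjointPart_apply_coe, invOf_eq_inv]

theorem skewPart_comp_subtypeL :
    (skewPart A).comp (skewAdjoint.submodule ℝ A).subtypeL = ContinuousLinearMap.id ℝ _ := by
  ext X
  simp only [ContinuousLinearMap.comp_apply, Submodule.subtypeL_apply, coe_skewPart]
  rw [show star (X : A) = -X from X.2, sub_neg_eq_add, ← two_smul ℝ (X : A), smul_smul]
  norm_num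

/-- Multiplication by `i` exchanges self-adjoint and skew-adjoint elements, so each is half of the
real dimension. This is the dimension of the unitary group. -/
theorem finrank_skewAdjoint :
    finrank ℝ (skewAdjoint.submodule ℝ A) = finrank ℂ A := by
  have : FiniteDimensional ℝ A := FiniteDimensional.complexToReal A
  let T : A →ₗ[ℝ] A :=
    { toFun := fun a => Complex.I • a
      map_add' := fun a b => smul_add _ a b
      map_smul' := fun r a => smul_comm _ r a }
  have hT : Function.Injective T := fun a b h => smul_right_injective A Complex.I_ne_zero h
  have e1 : finrank ℝ (selfAdjoint.submodule ℝ A) ≤ finrank ℝ (skewAdjoint.submodule ℝ A) := by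
    rw [← LinearMap.finrank_range_of_inj (f := T.comp (selfAdjoint.submodule ℝ A).subtype)
      (hT.comp Subtype.val_injective)]
    refine Submodule.finrank_mono ?_
    rintro _ ⟨x, rfl⟩
    change star (Complex.I • (x : A)) = -(Complex.I • (x : A))
    rw [star_smul, show star (x : A) = x from x.2]
    simp
  have e2 : finrank ℝ (skewAdjoint.submodule ℝ A) ≤ finrank ℝ (selfAdjoint.submodule ℝ A) := by
    rw [← LinearMap.finrank_range_of_inj (f := T.comp (skewAdjoint.submodule ℝ A).subtype)
      (hT.comp Subtype.val_injective)]
    refine Submodule.finrank_mono ?_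
    rintro _ ⟨x, rfl⟩
    change star (Complex.I • (x : A)) = Complex.I • (x : A)
    rw [star_smul, show star (x : A) = -x from x.2]
    simp
  have e3 : finrank ℝ A =
      finrank ℝ (selfAdjoint.submodule ℝ A × skewAdjoint.submodule ℝ A) :=
    (StarModule.decomposeProdAdjoint ℝ A).finrank_eq
  rw [Module.finrank_prod, finrank_real_of_complex] at e3
  omega

/-- Near `1`, a unitary is determined by its skew-adjoint part. -/
theorem eq_of_skewPart_eq {U V : A} (hU : U ∈ unitary A) (hV : V ∈ unitary A)
    (h1 : ‖1 - U‖ < 1 / 2) (h2 : ‖1 - V‖ < 1 / 2) (h : skewPart A U = skewPart A V) : U = V := by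
  have h' : U - star U = V - star V := by
    have := congrArg (Subtype.val) h
    rw [coe_skewPart, coe_skewPart] at this
    exact smul_right_injective A (by norm_num : (2⁻¹ : ℝ) ≠ 0) this
  set D := U - V with hD
  have hDs : star U = star V + D := by
    rw [hD, ← sub_eq_zero]
    rw [← sub_eq_zero] at h'
    rw [← neg_eq_zero, ← h']
    abel
  have hUV : U = V + D := by rw [hD]; abel
  -- `D` is self-adjoint because the skew parts agree; expand `1 = U U* = (V + D)(V* + D)` and use
  -- `V V* = 1`.
  have key : U * D + D * star V = 0 := by
    have a := (Unitary.mem_iff.1 hU).2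
    have b := (Unitary.mem_iff.1 hV).2
    rw [hDs, hUV, add_mul, mul_add, b, add_assoc, add_eq_left] at a
    rw [hUV, ← a]
    noncomm_ring
  -- Near the identity the relation reads `2D ≈ 0`; the error terms have total norm at most `‖D‖`,
  -- which forces `D = 0`.
  have key2 : (2 : ℝ) • D = (1 - U) * D + D * star (1 - V) := by
    have : (1 - U) * D + D * star (1 - V) = (2 : ℝ) • D - (U * D + D * star V) := by
      rw [two_smul, star_sub, star_one, sub_mul 1 U D, mul_sub D 1, one_mul, mul_one]
      abel
    rw [this, key, sub_zero]
  have hn : 2 * ‖D‖ ≤ (‖1 - U‖ + ‖1 - V‖) * ‖D‖ := by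
    calc 2 * ‖D‖ = ‖(2 : ℝ) • D‖ := by rw [norm_smul]; norm_num
      _ ≤ ‖(1 - U) * D‖ + ‖D * star (1 - V)‖ := by rw [key2]; exact norm_add_le _ _
      _ ≤ ‖1 - U‖ * ‖D‖ + ‖D‖ * ‖1 - V‖ := by
        refine add_le_add (norm_mul_le _ _) ((norm_mul_le _ _).trans ?_)
        rw [norm_star]
      _ = _ := by ring
  have : ‖D‖ = 0 := by nlinarith [norm_nonneg D]
  exact sub_eq_zero.1 (norm_eq_zero.1 this)

/-- A slice theorem: modulo the right action of a parametrized set of unitaries whose tangent map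
at the identity has a small kernel, the unitary group is parametrized by few real parameters. -/
theorem exists_countablyParametrized_slice {W : Type*} [NormedAddCommGroup W] [NormedSpace ℝ W]
    [FiniteDimensional ℝ W] {κ : W → A} {κ' : W →L[ℝ] skewAdjoint.submodule ℝ A}
    (hκ : HasStrictFDerivAt κ ((skewAdjoint.submodule ℝ A).subtypeL.comp κ') 0)
    (hu : ∀ w, κ w ∈ unitary A) (h0 : κ 0 = 1) {r : ℕ}
    (hr : finrank ℂ A + finrank ℝ (LinearMap.ker κ'.toLinearMap) ≤ r + finrank ℝ W) :
    ∃ T : Set A, CountablyParametrized r T ∧ T ⊆ unitary A ∧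
      ∀ V ∈ unitary A, ∃ t ∈ T, ∃ w, V = t * κ w := by
  have : FiniteDimensional ℝ A := FiniteDimensional.complexToReal A
  have : CompleteSpace W := FiniteDimensional.complete ℝ W
  have : ProperSpace A := FiniteDimensional.proper ℝ A
  -- `Q` is a transversal to the directions swept out by `κ`; exponentiating it gives the local
  -- slice.
  obtain ⟨Q, hQ⟩ := Submodule.exists_isCompl (LinearMap.range κ'.toLinearMap)
  have hQr : finrank ℝ Q ≤ r := by
    have a := Submodule.finrank_add_eq_of_isCompl hQ
    have b := κ'.toLinearMap.finrank_range_add_finrank_ker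
    rw [finrank_skewAdjoint] at a
    omega
  obtain ⟨m, hm⟩ : ∃ m : (Fin r → ℝ) →ₗ[ℝ] Q, Function.Surjective m := by
    let e : (Fin (finrank ℝ Q) → ℝ) ≃ₗ[ℝ] Q := (Module.finBasis ℝ Q).equivFun.symm
    exact ⟨e.toLinearMap.comp (LinearMap.funLeft ℝ ℝ (Fin.castLE hQr)),
      e.surjective.comp (LinearMap.funLeft_surjective_of_injective ℝ ℝ _
        (Fin.castLE_injective hQr))⟩
  let M : (Fin r → ℝ) →L[ℝ] skewAdjoint.submodule ℝ A :=
    LinearMap.toContinuousLinearMap (Q.subtype.comp m)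
  let Φ : (Fin r → ℝ) × W → A := fun z => skewExp (M z.1) * κ z.2
  have hΦu : ∀ z, Φ z ∈ unitary A := fun z => mul_mem (skewExp_mem_unitary _) (hu _)
  have hΦ0 : Φ 0 = 1 := by simp [Φ, h0, skewExp_zero]
  have hder : HasStrictFDerivAt (fun z => skewPart A (Φ z))
      (M.comp (ContinuousLinearMap.fst ℝ _ _) + κ'.comp (ContinuousLinearMap.snd ℝ _ _)) 0 := by
    have h1 : HasStrictFDerivAt (fun z : (Fin r → ℝ) × W => skewExp (M z.1))
        ((skewAdjoint.submodule ℝ A).subtypeL.comp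
          (M.comp (ContinuousLinearMap.fst ℝ _ _))) 0 := by
      have h : HasStrictFDerivAt (skewExp (A := A)) (skewAdjoint.submodule ℝ A).subtypeL
          ((M.comp (ContinuousLinearMap.fst ℝ (Fin r → ℝ) W)) 0) := by
        rw [map_zero]; exact hasStrictFDerivAt_skewExp
      exact h.comp 0 (ContinuousLinearMap.hasStrictFDerivAt _)
    have h2 : HasStrictFDerivAt (fun z : (Fin r → ℝ) × W => κ z.2)
        (((skewAdjoint.submodule ℝ A).subtypeL.comp κ').comp
          (ContinuousLinearMap.snd ℝ (Fin r → ℝ) W)) 0 :=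
      HasStrictFDerivAt.comp (f := fun z : (Fin r → ℝ) × W => z.2) 0 hκ
        (ContinuousLinearMap.hasStrictFDerivAt (ContinuousLinearMap.snd ℝ (Fin r → ℝ) W))
    have h3 := (skewPart A).hasStrictFDerivAt.comp (0 : (Fin r → ℝ) × W) (h1.mul' h2)
    refine h3.congr_fderiv ?_
    have hid : ∀ X : skewAdjoint.submodule ℝ A, skewPart A (X : A) = X := fun X =>
      DFunLike.congr_fun skewPart_comp_subtypeL X
    refine ContinuousLinearMap.ext fun z => ?_
    simp [h0, skewExp_zero, hid, add_comm]
  -- The range of `κ'` and `Q` span the tangent space, so `skewPart ∘ Φ` maps neighbourhoods of 0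
  -- onto neighbourhoods of its value there.
  have hsurj : (M.comp (ContinuousLinearMap.fst ℝ (Fin r → ℝ) W) +
      κ'.comp (ContinuousLinearMap.snd ℝ (Fin r → ℝ) W)).range = ⊤ := by
    refine LinearMap.range_eq_top.2 fun X => ?_
    have hX : X ∈ LinearMap.range κ'.toLinearMap ⊔ Q := by rw [hQ.sup_eq_top]; trivial
    obtain ⟨_, ⟨w, rfl⟩, q, hq, rfl⟩ := Submodule.mem_sup.1 hX
    obtain ⟨x, hx⟩ := hm ⟨q, hq⟩
    refine ⟨(x, w), ?_⟩
    simp [M, hx, add_comm]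
  have hmap := hder.map_nhds_eq_of_surj hsurj
  have hΦc : ContinuousAt Φ 0 := by
    have h1 : Continuous fun z : (Fin r → ℝ) × W => skewExp (M z.1) :=
      contDiff_skewExp.continuous.comp (M.continuous.comp continuous_fst)
    have h2 : ContinuousAt (fun z : (Fin r → ℝ) × W => κ z.2) 0 :=
      ContinuousAt.comp (f := fun z : (Fin r → ℝ) × W => z.2) hκ.continuousAt
        continuous_snd.continuousAt
    exact h1.continuousAt.mul h2
  have hball : {a : A | ‖1 - a‖ < 1 / 2} ∈ 𝓝 (1 : A) := by
    refine (isOpen_lt (by fun_prop) continuous_const).mem_nhds ?_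
    simp
  have hnear : {z | ‖1 - Φ z‖ < 1 / 2} ∈ 𝓝 (0 : (Fin r → ℝ) × W) := by
    have h : Filter.Tendsto Φ (𝓝 0) (𝓝 1) := hΦ0 ▸ hΦc
    exact h hball
  have himg : (skewPart A) ⁻¹' ((fun z => skewPart A (Φ z)) '' {z | ‖1 - Φ z‖ < 1 / 2}) ∈
      𝓝 (1 : A) := by
    refine (skewPart A).continuous.continuousAt ?_
    have h : 𝓝 (skewPart A 1) = Filter.map (fun z => skewPart A (Φ z)) (𝓝 0) := by
      rw [hmap, hΦ0]
    rw [h]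
    exact Filter.image_mem_map hnear
  -- Injectivity of the skew part on unitaries near 1 upgrades equality of skew parts to `V = Φ z`.
  have hloc : ∀ᶠ V in 𝓝 (1 : A), V ∈ unitary A → ∃ z, V = Φ z := by
    filter_upwards [himg, hball] with V ⟨z, hz, hzV⟩ hV hVu
    exact ⟨z, eq_of_skewPart_eq hVu (hΦu z) hV hz hzV.symm⟩
  -- Countably many left translates of this neighbourhood of 1 cover the group; left translation
  -- leaves the right factor `κ w` intact.
  obtain ⟨s, hs, hcov⟩ := TopologicalSpace.countable_cover_nhds (α := unitary A)
    (f := fun V₀ => {V | ∃ z, star (V₀ : A) * V = Φ z}) (by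
      intro V₀
      have hc : Filter.Tendsto (fun V : unitary A => star (V₀ : A) * V) (𝓝 V₀) (𝓝 1) := by
        have : Continuous fun V : unitary A => star (V₀ : A) * V := by fun_prop
        simpa using this.tendsto V₀
      filter_upwards [hc.eventually hloc] with V hV
      exact hV (mul_mem (Unitary.star_mem V₀.2) V.2))
  refine ⟨⋃ V₀ : s, Set.range fun x => (V₀ : A) * skewExp (M x), ?_, ?_, ?_⟩
  · have : Countable s := hs
    refine CountablyParametrized.iUnion fun V₀ => ⟨{fun x => (V₀ : A) * skewExp (M x)},
      Set.countable_singleton _, ?_, fun y hy => ⟨_, rfl, hy⟩⟩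
    rintro _ rfl
    exact contDiff_const.mul (contDiff_skewExp.comp M.contDiff)
  · intro y hy
    obtain ⟨V₀, x, rfl⟩ := Set.mem_iUnion.1 hy
    exact mul_mem V₀.1.2 (skewExp_mem_unitary _)
  · intro V hV
    have : (⟨V, hV⟩ : unitary A) ∈ ⋃ x ∈ s, {V : unitary A | ∃ z, star (x : A) * V = Φ z} := by
      rw [hcov]; trivial
    obtain ⟨V₀, h₀, z, hz⟩ := Set.mem_iUnion₂.1 this
    refine ⟨V₀ * skewExp (M z.1), Set.mem_iUnion.2 ⟨⟨V₀, h₀⟩, z.1, rfl⟩, z.2, ?_⟩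
    rw [mul_assoc]
    change _ = (V₀ : A) * Φ z
    rw [← hz, ← mul_assoc]
    simp

/-- The `C¹` image of a space of too small dimension is Haar-null in the unitary group. -/
theorem measure_coe_preimage_range_eq_zero [MeasurableSpace (unitary A)] [BorelSpace (unitary A)]
    (μ : Measure (unitary A)) [SFinite μ] [μ.IsMulLeftInvariant] {d : ℕ} (hd : d < finrank ℂ A)
    {f : (Fin d → ℝ) → A} (hf : ContDiff ℝ 1 f) :
    μ {U | (U : A) ∈ Set.range f} = 0 := by
  have : FiniteDimensional ℝ A := FiniteDimensional.complexToReal A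
  have : ProperSpace A := FiniteDimensional.proper ℝ A
  have hS : MeasurableSet {U : unitary A | (U : A) ∈ Set.range f} := by
    borelize A
    have h : MeasurableSet (Set.range f) := by
      rw [← Set.image_univ, ← iUnion_compactCovering, Set.image_iUnion]
      exact MeasurableSet.iUnion fun k =>
        ((isCompact_compactCovering _ k).image hf.continuous).measurableSet
    exact (continuous_subtype_val (p := (· ∈ unitary A))).measurable h
  let _ : MeasurableSpace (skewAdjoint.submodule ℝ A) := borel _
  have : BorelSpace (skewAdjoint.submodule ℝ A) := ⟨rfl⟩
  -- Top-dimensional Hausdorff measure is both additive Haar, hence positive on open sets, and zero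
  -- on sets of smaller Hausdorff dimension.
  let ν : Measure (skewAdjoint.submodule ℝ A) := μH[finrank ℝ (skewAdjoint.submodule ℝ A)]
  have hν : ν.IsAddHaarMeasure := isAddHaarMeasure_hausdorffMeasure
  let E : skewAdjoint.submodule ℝ A → unitary A := fun X => ⟨skewExp X, skewExp_mem_unitary X⟩
  have hE : Continuous E := contDiff_skewExp.continuous.subtype_mk _
  let g : skewAdjoint.submodule ℝ A → skewAdjoint.submodule ℝ A := fun X => skewPart A (skewExp X)
  have hg : HasStrictFDerivAt g
      ((ContinuousLinearEquiv.refl ℝ (skewAdjoint.submodule ℝ A)) : _ →L[ℝ] _) 0 :=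
    ((skewPart A).hasStrictFDerivAt.comp 0 hasStrictFDerivAt_skewExp).congr_fderiv
      skewPart_comp_subtypeL
  obtain ⟨s, h0s, hso, hs⟩ := hg.approximates_deriv_on_open_nhds
  -- Near 0, `g` is close to the identity, so it cannot lower Hausdorff dimension.
  have hanti := hs.antilipschitz
    ((ContinuousLinearEquiv.refl ℝ _).subsingleton_or_nnnorm_symm_pos.imp id fun h =>
      NNReal.half_lt_self (inv_pos.2 h).ne')
  have hsν : ν s ≠ 0 := (hso.measure_pos ν ⟨0, h0s⟩).ne'
  -- For fixed `U`, the `X` in `s` with `exp(X) U` in the range of `f` are sent by `g` into a `C¹`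
  -- image of `ℝ^d`.
  have hfib : ∀ U : unitary A, ν.restrict s {X | ((E X * U : unitary A) : A) ∈ Set.range f} = 0 := by
    intro U
    rw [Measure.restrict_apply' hso.measurableSet]
    refine hausdorffMeasure_of_dimH_lt (d := finrank ℝ (skewAdjoint.submodule ℝ A)) ?_
    set B : Set s := {X | ((E X * U : unitary A) : A) ∈ Set.range f}
    have hB : {X | ((E X * U : unitary A) : A) ∈ Set.range f} ∩ s = Subtype.val '' B := by
      ext X
      simp [B, and_comm]
    rw [hB, isometry_subtype_coe.dimH_image]
    have hsub : s.domRestrict g '' B ⊆ Set.range fun z => skewPart A (f z * star (U : A)) := by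
      rintro _ ⟨X, ⟨z, hz⟩, rfl⟩
      refine ⟨z, ?_⟩
      simp only [hz]
      simp [g, E, mul_assoc]
    calc dimH B ≤ dimH (s.domRestrict g '' B) := hanti.le_dimH_image B
      _ ≤ _ := dimH_mono hsub
      _ ≤ finrank ℝ (Fin d → ℝ) := ((skewPart A).contDiff.comp
            (hf.mul contDiff_const)).dimH_range_le
      _ < _ := by
        rw [finrank_skewAdjoint]
        simpa using hd
  have hmeas : MeasurableSet {p : skewAdjoint.submodule ℝ A × unitary A |
      ((E p.1 * p.2 : unitary A) : A) ∈ Set.range f} := by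
    have : Continuous fun p : skewAdjoint.submodule ℝ A × unitary A => E p.1 * p.2 := by fun_prop
    exact this.measurable hS
  -- Fubini: the slices at fixed `U` are null, so almost every slice at fixed `X` is null. One such
  -- `X` suffices, since left translation by `exp X` preserves `μ`.
  have hprod : ((ν.restrict s).prod μ) {p : skewAdjoint.submodule ℝ A × unitary A |
      ((E p.1 * p.2 : unitary A) : A) ∈ Set.range f} = 0 := by
    rw [← Measure.prod_swap, Measure.map_apply measurable_swap hmeas,
      Measure.measure_prod_null (measurable_swap hmeas)]
    exact Filter.Eventually.of_forall hfib
  have hae := Measure.measure_ae_null_of_prod_null hprod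
  have : (ν.restrict s) ≠ 0 := by rwa [Ne, Measure.restrict_eq_zero]
  have : (MeasureTheory.ae (ν.restrict s)).NeBot := ae_neBot.2 this
  obtain ⟨X, hX⟩ := hae.exists
  rw [← measure_preimage_mul μ (E X)]
  exact hX

/-- Countably parametrized sets of too small dimension are Haar-null in the unitary group. -/
theorem CountablyParametrized.measure_unitary_eq_zero [MeasurableSpace (unitary A)]
    [BorelSpace (unitary A)] (μ : Measure (unitary A)) [SFinite μ] [μ.IsMulLeftInvariant] {d : ℕ}
    (hd : d < finrank ℂ A) {S : Set A} (hS : CountablyParametrized d S) :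
    μ {U | (U : A) ∈ S} = 0 := by
  obtain ⟨P, hP, hc, hs⟩ := hS
  refine measure_mono_null (t := ⋃ f ∈ P, {U : unitary A | (U : A) ∈ Set.range f}) ?_ ?_
  · intro U hU
    obtain ⟨f, hf, h⟩ := hs U hU
    exact Set.mem_iUnion₂.2 ⟨f, hf, h⟩
  · exact (measure_biUnion_null_iff hP).2 fun f hf =>
      measure_coe_preimage_range_eq_zero μ hd (hc f hf)

end UnitaryGroup

/-! ### Slices modulo the unitaries of two subalgebras -/

section TwoCommutingSubalgebras

variable {A B C : Type*} [CStarAlgebra A] [CStarAlgebra B] [CStarAlgebra C]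
  [FiniteDimensional ℂ A] [FiniteDimensional ℂ B]

/-- The action of a `*`-homomorphism on skew-adjoint elements. -/
noncomputable def skewMap (φ : A →⋆ₐ[ℂ] C) :
    skewAdjoint.submodule ℝ A →L[ℝ] skewAdjoint.submodule ℝ C :=
  have : FiniteDimensional ℝ A := FiniteDimensional.complexToReal A
  LinearMap.toContinuousLinearMap
    { toFun := fun X => ⟨φ X, by
        change star (φ X) = -φ X
        rw [← map_star, show star (X : A) = -X from X.2, map_neg]⟩
      map_add' := fun X Y => Subtype.ext (map_add φ (X : A) Y)
      map_smul' := fun r X => Subtype.ext (map_smul φ (r : ℂ) (X : A)) }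

theorem hasStrictFDerivAt_map_skewExp (φ : A →⋆ₐ[ℂ] C) :
    HasStrictFDerivAt (fun X => φ (skewExp X))
      ((skewAdjoint.submodule ℝ C).subtypeL.comp (skewMap φ)) 0 := by
  have : FiniteDimensional ℝ A := FiniteDimensional.complexToReal A
  let φ' : A →L[ℝ] C := LinearMap.toContinuousLinearMap (φ.toAlgHom.toLinearMap.restrictScalars ℝ)
  exact φ'.hasStrictFDerivAt.comp 0 hasStrictFDerivAt_skewExp

/-- If `φ X + ψ Y = 0`, then `X` and `-Y` are the same scalar, which is imaginary; so the kernel is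
spanned by `(i, -i)`. This is the phase that can be moved between the two factors. -/
theorem finrank_ker_skewMap_le [Nontrivial A] (φ : A →⋆ₐ[ℂ] C) (ψ : B →⋆ₐ[ℂ] C)
    (h : ∀ a b, φ a = ψ b → ∃ z : ℂ, a = z • 1 ∧ b = z • 1) :
    finrank ℝ (LinearMap.ker ((skewMap φ).comp (ContinuousLinearMap.fst ℝ _ _) +
      (skewMap ψ).comp (ContinuousLinearMap.snd ℝ _ _)).toLinearMap) ≤ 1 := by
  let a₀ : skewAdjoint.submodule ℝ A := ⟨Complex.I • 1, by
    change star (Complex.I • (1 : A)) = -(Complex.I • (1 : A))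
    simp [star_smul]⟩
  let b₀ : skewAdjoint.submodule ℝ B := ⟨-(Complex.I • 1), by
    change star (-(Complex.I • (1 : B))) = -(-(Complex.I • (1 : B)))
    simp [star_smul]⟩
  refine (Submodule.finrank_mono (t := Submodule.span ℝ {(a₀, b₀)}) ?_).trans
    ((finrank_span_le_card _).trans (by simp))
  rintro ⟨X, Y⟩ hXY
  have h1 : φ X + ψ Y = 0 := congrArg Subtype.val (LinearMap.mem_ker.1 hXY)
  obtain ⟨z, hz, hz'⟩ := h X (-Y) (by rw [map_neg]; exact eq_neg_of_add_eq_zero_left h1)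
  have h2 : star (X : A) = -X := X.2
  have h3 : (starRingEnd ℂ) z = -z := by
    rw [hz, star_smul, star_one, ← neg_smul] at h2
    exact smul_left_injective ℂ (one_ne_zero : (1 : A) ≠ 0) h2
  have hre : z.re = 0 := by
    have := congrArg Complex.re h3
    simp at this
    linarith
  have hzI : z = (z.im : ℂ) * Complex.I := by
    apply Complex.ext <;> simp [hre]
  refine Submodule.mem_span_singleton.2 ⟨z.im, Prod.ext (Subtype.ext ?_) (Subtype.ext ?_)⟩
  · change ((z.im : ℂ) • (Complex.I • (1 : A))) = X
    rw [hz, smul_smul, ← hzI]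
  · change ((z.im : ℂ) • (-(Complex.I • (1 : B)))) = Y
    rw [smul_neg, smul_smul, ← hzI, ← hz', neg_neg]

/-- The slice theorem for the right action of the unitaries of two subalgebras that meet
in the scalars. -/
theorem exists_countablyParametrized_slice_of_starAlgHom [FiniteDimensional ℂ C] [Nontrivial A]
    (φ : A →⋆ₐ[ℂ] C)
    (ψ : B →⋆ₐ[ℂ] C) (h : ∀ a b, φ a = ψ b → ∃ z : ℂ, a = z • 1 ∧ b = z • 1) {r : ℕ}
    (hr : finrank ℂ C + 1 ≤ r + (finrank ℂ A + finrank ℂ B)) :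
    ∃ T : Set C, CountablyParametrized r T ∧ T ⊆ unitary C ∧
      ∀ V ∈ unitary C, ∃ t ∈ T, ∃ a ∈ unitary A, ∃ b ∈ unitary B, V = t * (φ a * ψ b) := by
  have : FiniteDimensional ℝ A := FiniteDimensional.complexToReal A
  have : FiniteDimensional ℝ B := FiniteDimensional.complexToReal B
  let κ : skewAdjoint.submodule ℝ A × skewAdjoint.submodule ℝ B → C :=
    fun w => φ (skewExp w.1) * ψ (skewExp w.2)
  have hκ : HasStrictFDerivAt κ ((skewAdjoint.submodule ℝ C).subtypeL.comp
      ((skewMap φ).comp (ContinuousLinearMap.fst ℝ _ _) +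
      (skewMap ψ).comp (ContinuousLinearMap.snd ℝ _ _))) 0 := by
    have h1 := HasStrictFDerivAt.comp
      (f := fun w : skewAdjoint.submodule ℝ A × skewAdjoint.submodule ℝ B => w.1) 0
      (hasStrictFDerivAt_map_skewExp φ)
      (ContinuousLinearMap.hasStrictFDerivAt (ContinuousLinearMap.fst ℝ
        (skewAdjoint.submodule ℝ A) (skewAdjoint.submodule ℝ B)))
    have h2 := HasStrictFDerivAt.comp
      (f := fun w : skewAdjoint.submodule ℝ A × skewAdjoint.submodule ℝ B => w.2) 0
      (hasStrictFDerivAt_map_skewExp ψ)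
      (ContinuousLinearMap.hasStrictFDerivAt (ContinuousLinearMap.snd ℝ
        (skewAdjoint.submodule ℝ A) (skewAdjoint.submodule ℝ B)))
    refine (h1.mul' h2).congr_fderiv (ContinuousLinearMap.ext fun w => ?_)
    simp [skewExp_zero, add_comm]
  obtain ⟨T, hT, hTu, hTs⟩ := exists_countablyParametrized_slice hκ
    (fun w => mul_mem (Unitary.map_mem φ (skewExp_mem_unitary w.1))
      (Unitary.map_mem ψ (skewExp_mem_unitary w.2)))
    (by simp [κ, skewExp_zero]) (r := r) (by
      have := finrank_ker_skewMap_le φ ψ h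
      rw [Module.finrank_prod, finrank_skewAdjoint, finrank_skewAdjoint]
      omega)
  refine ⟨T, hT, hTu, fun V hV => ?_⟩
  obtain ⟨t, ht, w, hw⟩ := hTs V hV
  exact ⟨t, ht, _, skewExp_mem_unitary w.1, _, skewExp_mem_unitary w.2, hw⟩

end TwoCommutingSubalgebras

/-! ### Matrices as a C⋆-algebra under the operator norm; entrywise smoothness -/

open scoped Kronecker Matrix.Norms.L2Operator

section SmoothMatrices

variable {E ι : Type*} [NormedAddCommGroup E] [NormedSpace ℝ E] [Fintype ι] [DecidableEq ι]

theorem contDiff_matrix_entry (i j : ι) :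
    ContDiff ℝ 1 (fun M : Matrix ι ι ℂ => M i j) := by
  let e : Matrix ι ι ℂ →L[ℂ] ℂ := LinearMap.toContinuousLinearMap
    { toFun := fun M => M i j, map_add' := fun _ _ => rfl, map_smul' := fun _ _ => rfl }
  exact (e.restrictScalars ℝ).contDiff

theorem contDiff_matrix {f : E → Matrix ι ι ℂ} (h : ∀ i j, ContDiff ℝ 1 fun x => f x i j) :
    ContDiff ℝ 1 f := by
  have hf : f = fun x => ∑ i, ∑ j, (f x i j) • Matrix.single i j (1 : ℂ) := by
    ext1 x
    conv_lhs => rw [Matrix.matrix_eq_sum_single (f x)]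
    simp [Matrix.smul_single]
  rw [hf]
  exact ContDiff.sum fun i _ => ContDiff.sum fun j _ => (h i j).smul contDiff_const

end SmoothMatrices

/-! ### Parameter counts for one- and two-qubit gates -/

section Slices

local notation "M₂" => Matrix (Fin 2) (Fin 2) ℂ
local notation "M₄" => Matrix (Fin 2 × Fin 2) (Fin 2 × Fin 2) ℂ

/-- One-qubit gates up to phases depend on three real parameters. -/
theorem exists_slice_one_qubit :
    ∃ T : Set M₂, CountablyParametrized 3 T ∧ T ⊆ unitary M₂ ∧
      ∀ V ∈ unitary M₂, ∃ t ∈ T, ∃ z : ℂ, ‖z‖ = 1 ∧ V = z • t := by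
  -- Both subalgebras are the scalars; the count is `4 + 1 = 3 + (1 + 1)`, the duplicated phase
  -- being offset by the kernel.
  obtain ⟨T, hT, hTu, hTs⟩ := exists_countablyParametrized_slice_of_starAlgHom
    (StarAlgHom.ofId ℂ M₂) (StarAlgHom.ofId ℂ M₂) (r := 3) (by
      intro a b hab
      have : a = b := by
        have : algebraMap ℂ M₂ a 0 0 = algebraMap ℂ M₂ b 0 0 := congrFun (congrFun hab 0) 0
        simpa [Matrix.algebraMap_matrix_apply] using this
      exact ⟨a, by simp, by simp [this]⟩) (by simp [Module.finrank_matrix])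
  refine ⟨T, hT, hTu, fun V hV => ?_⟩
  obtain ⟨t, ht, a, ha, b, hb, h⟩ := hTs V hV
  refine ⟨t, ht, a * b, ?_, ?_⟩
  · rw [norm_mul, CStarRing.norm_of_mem_unitary ha, CStarRing.norm_of_mem_unitary hb, one_mul]
  · rw [h, ← map_mul]
    change t * algebraMap ℂ M₂ (a * b) = _
    rw [Algebra.algebraMap_eq_smul_one, mul_smul_comm, mul_one]

/-- The embedding of the algebra of the first qubit into the algebra of two qubits. -/
noncomputable def kroneckerOneHom : M₂ →⋆ₐ[ℂ] M₄ where
  toFun a := a ⊗ₖ 1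
  map_one' := Matrix.one_kronecker_one
  map_mul' a b := by rw [← Matrix.mul_kronecker_mul, mul_one]
  map_zero' := Matrix.zero_kronecker _
  map_add' a b := Matrix.add_kronecker _ _ _
  commutes' z := by
    rw [Algebra.algebraMap_eq_smul_one, Algebra.algebraMap_eq_smul_one, Matrix.smul_kronecker,
      Matrix.one_kronecker_one]
  map_star' a := by
    rw [Matrix.star_eq_conjTranspose, Matrix.star_eq_conjTranspose, Matrix.conjTranspose_kronecker,
      Matrix.conjTranspose_one]

/-- The embedding of the algebra of the second qubit into the algebra of two qubits. -/
noncomputable def oneKroneckerHom : M₂ →⋆ₐ[ℂ] M₄ where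
  toFun a := 1 ⊗ₖ a
  map_one' := Matrix.one_kronecker_one
  map_mul' a b := by rw [← Matrix.mul_kronecker_mul, mul_one]
  map_zero' := Matrix.kronecker_zero _
  map_add' a b := Matrix.kronecker_add _ _ _
  commutes' z := by
    rw [Algebra.algebraMap_eq_smul_one, Algebra.algebraMap_eq_smul_one, Matrix.kronecker_smul,
      Matrix.one_kronecker_one]
  map_star' a := by
    rw [Matrix.star_eq_conjTranspose, Matrix.star_eq_conjTranspose, Matrix.conjTranspose_kronecker,
      Matrix.conjTranspose_one]

/-- Two-qubit gates up to local gates depend on nine real parameters. -/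
theorem exists_slice_two_qubit :
    ∃ T : Set M₄, CountablyParametrized 9 T ∧ T ⊆ unitary M₄ ∧
      ∀ V ∈ unitary M₄, ∃ t ∈ T, ∃ a ∈ unitary M₂, ∃ b ∈ unitary M₂, V = t * (a ⊗ₖ b) := by
  obtain ⟨T, hT, hTu, hTs⟩ := exists_countablyParametrized_slice_of_starAlgHom
    -- `16 + 1 = 9 + (4 + 4)`. Comparing entries of `a ⊗ 1 = 1 ⊗ b` shows that both are the scalar
    -- `a 0 0`.
    kroneckerOneHom oneKroneckerHom (r := 9) (by
      intro a b hab
      have h : ∀ i j k l, a i k * (1 : M₂) j l = (1 : M₂) i k * b j l := fun i j k l =>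
        congrFun (congrFun hab (i, j)) (k, l)
      refine ⟨a 0 0, ?_, ?_⟩
      · ext i k
        have h1 := h i 0 k 0
        have h2 := h 0 0 0 0
        simp only [Matrix.one_apply_eq, mul_one, one_mul] at h1 h2
        rw [h1, h2, Matrix.smul_apply, smul_eq_mul, mul_comm]
      · ext j l
        have h1 := h 0 j 0 l
        simp only [Matrix.one_apply_eq, one_mul] at h1
        rw [← h1, Matrix.smul_apply, smul_eq_mul]) (by simp [Module.finrank_matrix])
  refine ⟨T, hT, hTu, fun V hV => ?_⟩
  obtain ⟨t, ht, a, ha, b, hb, h⟩ := hTs V hV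
  refine ⟨t, ht, a, ha, b, hb, ?_⟩
  rw [h]
  change t * ((a ⊗ₖ 1) * (1 ⊗ₖ b)) = _
  rw [← Matrix.mul_kronecker_mul, mul_one, one_mul]

end Slices

/-! ### Local unitaries on `n` qubits -/

section TensorMatrix

variable {ι : Type*} [Fintype ι]

/-- The tensor product of one-qubit operators. -/
def tensorMatrix (a : ι → Matrix (Fin 2) (Fin 2) ℂ) : Matrix (ι → Fin 2) (ι → Fin 2) ℂ :=
  fun x y => ∏ i, a i (x i) (y i)

theorem tensorMatrix_one : tensorMatrix (1 : ι → Matrix (Fin 2) (Fin 2) ℂ) = 1 := by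
  classical
  ext x y
  simp only [tensorMatrix, Pi.one_apply, Matrix.one_apply, Finset.prod_ite_zero,
    Finset.prod_const_one, Finset.mem_univ, true_imp_iff, funext_iff]

theorem tensorMatrix_mul [DecidableEq ι] (a b : ι → Matrix (Fin 2) (Fin 2) ℂ) :
    tensorMatrix a * tensorMatrix b = tensorMatrix (a * b) := by
  ext x y
  simp only [tensorMatrix, Pi.mul_apply, Matrix.mul_apply, ← Finset.prod_mul_distrib]
  rw [Finset.prod_univ_sum, Fintype.piFinset_univ]

theorem tensorMatrix_smul (z : ι → ℂ) (a : ι → Matrix (Fin 2) (Fin 2) ℂ) :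
    tensorMatrix (fun i => z i • a i) = (∏ i, z i) • tensorMatrix a := by
  ext x y
  simp [tensorMatrix, Finset.prod_mul_distrib]

theorem contDiff_smul_tensorMatrix [DecidableEq ι] :
    ContDiff ℝ 1 (fun p : ℂ × (ι → Matrix (Fin 2) (Fin 2) ℂ) => p.1 • tensorMatrix p.2) := by
  refine contDiff_fst.smul (contDiff_matrix fun x y => contDiff_prod fun i _ => ?_)
  exact (contDiff_matrix_entry (x i) (y i)).comp ((contDiff_apply ℝ _ i).comp contDiff_snd)

/-- Local unitaries on `n` qubits depend on `3 n + 1` real parameters. -/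
theorem countablyParametrized_tensorMatrix (n : ℕ) :
    CountablyParametrized (1 + n * 3)
      {M | ∃ a : Fin n → Matrix (Fin 2) (Fin 2) ℂ,
        (∀ i, a i ∈ unitary (Matrix (Fin 2) (Fin 2) ℂ)) ∧ M = tensorMatrix a} := by
  obtain ⟨T, hT, -, hTs⟩ := exists_slice_one_qubit
  have hc : CountablyParametrized 1 {z : ℂ | ‖z‖ = 1} := by
    refine ⟨{fun x => Complex.exp ((x 0 : ℝ) * Complex.I)}, Set.countable_singleton _, ?_, ?_⟩
    · rintro _ rfl
      exact Complex.contDiff_exp.comp ((Complex.ofRealCLM.contDiff.comp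
        (contDiff_apply ℝ ℝ (0 : Fin 1))).mul contDiff_const)
    · intro z hz
      obtain ⟨θ, rfl⟩ := (Complex.norm_eq_one_iff z).1 hz
      exact ⟨_, rfl, fun _ => θ, rfl⟩
  refine ((hc.prod (hT.pi (n := n))).image contDiff_smul_tensorMatrix).mono ?_
  rintro _ ⟨a, ha, rfl⟩
  choose t ht z hz h using fun i => hTs (a i) (ha i)
  -- The `n` phases merge into a single one, giving `3n + 1` parameters rather than `4n`.
  refine ⟨(∏ i, z i, t), ⟨?_, ht⟩, ?_⟩
  · simp [norm_prod, hz]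
  · change (∏ i, z i) • tensorMatrix t = tensorMatrix a
    rw [← tensorMatrix_smul]
    exact congrArg tensorMatrix (funext fun i => (h i).symm)

end TensorMatrix

/-! ### Two-qubit gates on the register and their exchange with local gates -/

section TwoQubitMatrix

variable {n : ℕ}

/-- The operator of a two-qubit gate tensored with the identity on the other qubits. -/
def twoQubitMatrix (i j : Fin n) (V : Matrix (Fin 2 × Fin 2) (Fin 2 × Fin 2) ℂ) :
    Matrix (QubitBasis n) (QubitBasis n) ℂ := fun x y =>
  if ∀ l, l ≠ i → l ≠ j → x l = y l then V (x i, x j) (y i, y j) else 0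

/-- Separating two qubits from the others. -/
def splitQubits {i j : Fin n} (hij : i ≠ j) :
    QubitBasis n ≃ (Fin 2 × Fin 2) × ({l : Fin n // l ≠ i ∧ l ≠ j} → Fin 2) where
  toFun x := ((x i, x j), fun l => x l)
  invFun p l := if hi : l = i then p.1.1 else if hj : l = j then p.1.2 else p.2 ⟨l, hi, hj⟩
  left_inv x := by
    ext1 l
    by_cases hi : l = i
    · simp [hi]
    · by_cases hj : l = j <;> simp [hj, hij.symm, hi]
  right_inv p := by
    refine Prod.ext (Prod.ext (by simp) (by simp [hij.symm])) ?_
    ext1 l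
    simp [l.2.1, l.2.2]

theorem twoQubitMatrix_eq {i j : Fin n} (hij : i ≠ j)
    (V : Matrix (Fin 2 × Fin 2) (Fin 2 × Fin 2) ℂ) :
    twoQubitMatrix i j V = (V ⊗ₖ (1 : Matrix ({l : Fin n // l ≠ i ∧ l ≠ j} → Fin 2) _ ℂ)).submatrix
      (splitQubits hij) (splitQubits hij) := by
  ext x y
  simp [twoQubitMatrix, splitQubits, Matrix.one_apply, funext_iff]

theorem tensorMatrix_eq {i j : Fin n} (hij : i ≠ j) (a : Fin n → Matrix (Fin 2) (Fin 2) ℂ) :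
    tensorMatrix a = ((a i ⊗ₖ a j) ⊗ₖ
      tensorMatrix fun l : {l : Fin n // l ≠ i ∧ l ≠ j} => a l).submatrix
        (splitQubits hij) (splitQubits hij) := by
  ext x y
  simp only [tensorMatrix, splitQubits, Matrix.submatrix_apply, Equiv.coe_fn_mk,
    Matrix.kronecker_apply]
  rw [← Finset.prod_subtype (Finset.univ.filter fun l => l ≠ i ∧ l ≠ j) (by simp)
    (fun l => a l (x l) (y l))]
  rw [show (Finset.univ.filter fun l => l ≠ i ∧ l ≠ j) = (Finset.univ.erase i).erase j by
    ext l; simp [and_comm]]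
  rw [mul_assoc, Finset.mul_prod_erase _ (fun l => a l (x l) (y l)) (by simp [hij.symm]),
    Finset.mul_prod_erase _ (fun l => a l (x l) (y l)) (by simp)]

/-- The exchange rule behind the normal form: after splitting off qubits `i` and `j`, both sides are
Kronecker products. The hypothesis gives the first factor, and the other qubits are untouched. -/
theorem tensorMatrix_mul_twoQubitMatrix {i j : Fin n} (hij : i ≠ j)
    (a : Fin n → Matrix (Fin 2) (Fin 2) ℂ) {V t : Matrix (Fin 2 × Fin 2) (Fin 2 × Fin 2) ℂ}
    {b c : Matrix (Fin 2) (Fin 2) ℂ} (h : (a i ⊗ₖ a j) * V = t * (b ⊗ₖ c)) :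
    tensorMatrix a * twoQubitMatrix i j V = twoQubitMatrix i j t *
      tensorMatrix (Function.update (Function.update a i b) j c) := by
  have hr : (fun l : {l : Fin n // l ≠ i ∧ l ≠ j} =>
      Function.update (Function.update a i b) j c l) =
      fun l : {l : Fin n // l ≠ i ∧ l ≠ j} => a l := by
    ext1 l
    simp [l.2.1, l.2.2]
  rw [tensorMatrix_eq hij, twoQubitMatrix_eq hij, tensorMatrix_eq hij, twoQubitMatrix_eq hij,
    Matrix.submatrix_mul_equiv, Matrix.submatrix_mul_equiv, ← Matrix.mul_kronecker_mul,
    ← Matrix.mul_kronecker_mul, mul_one, one_mul, h, hr]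
  simp [hij]

theorem contDiff_twoQubitMatrix (i j : Fin n) : ContDiff ℝ 1 (twoQubitMatrix i j) := by
  refine contDiff_matrix fun x y => ?_
  unfold twoQubitMatrix
  split_ifs
  · exact contDiff_matrix_entry _ _
  · exact contDiff_const

theorem oneQubitGate_toMatrix (i : Fin n) (u : Matrix.unitaryGroup (Fin 2) ℂ) :
    (QubitGate.one i u).toMatrix = tensorMatrix (Function.update 1 i (u : Matrix _ _ ℂ)) := by
  ext x y
  simp only [QubitGate.toMatrix, tensorMatrix]
  rw [← Finset.mul_prod_erase _ _ (Finset.mem_univ i)]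
  have : ∀ l ∈ Finset.univ.erase i, (Function.update (1 : Fin n → Matrix (Fin 2) (Fin 2) ℂ) i
      (u : Matrix _ _ ℂ) l) (x l) (y l) = if x l = y l then 1 else 0 := by
    intro l hl
    rw [Function.update_of_ne (Finset.ne_of_mem_erase hl), Pi.one_apply, Matrix.one_apply]
  rw [Finset.prod_congr rfl this, Finset.prod_ite_zero]
  simp

end TwoQubitMatrix

/-! ### Normal form of circuits and the lower bound -/

section Circuits

variable {n : ℕ}

/-- Products of `k` operators of two-qubit gates taken from the set `T`. -/
def twoQubitProducts (n : ℕ) (T : Set (Matrix (Fin 2 × Fin 2) (Fin 2 × Fin 2) ℂ)) :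
    ℕ → Set (Matrix (QubitBasis n) (QubitBasis n) ℂ)
  | 0 => {1}
  | k + 1 => ⋃ p : Fin n × Fin n, (fun z : Matrix (QubitBasis n) (QubitBasis n) ℂ ×
      Matrix (Fin 2 × Fin 2) (Fin 2 × Fin 2) ℂ => z.1 * twoQubitMatrix p.1 p.2 z.2) ''
        (twoQubitProducts n T k ×ˢ T)

/-- Choosing the pair of qubits costs only a finite union. Degenerate pairs `(i, i)` are harmless,
as only an upper bound on the dimension is needed. -/
theorem countablyParametrized_twoQubitProducts (n : ℕ)
    {T : Set (Matrix (Fin 2 × Fin 2) (Fin 2 × Fin 2) ℂ)} {d : ℕ} (hT : CountablyParametrized d T)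
    (k : ℕ) : CountablyParametrized (k * d) (twoQubitProducts n T k) := by
  induction k with
  | zero => exact countablyParametrized_singleton _ _
  | succ k ih =>
    rw [add_mul, one_mul]
    exact CountablyParametrized.iUnion fun p => (ih.prod hT).image
      (contDiff_fst.mul ((contDiff_twoQubitMatrix p.1 p.2).comp contDiff_snd))

/-- Induction on the circuit, keeping all local factors on the right, where the next gate is
multiplied: a one-qubit gate joins them, and a two-qubit gate absorbs the factors on its qubits and
is split again by the slice. -/
theorem QubitCircuit.exists_toMatrix_eq {T : Set (Matrix (Fin 2 × Fin 2) (Fin 2 × Fin 2) ℂ)}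
    (hT : ∀ V ∈ unitary (Matrix (Fin 2 × Fin 2) (Fin 2 × Fin 2) ℂ), ∃ t ∈ T,
      ∃ a ∈ unitary (Matrix (Fin 2) (Fin 2) ℂ), ∃ b ∈ unitary (Matrix (Fin 2) (Fin 2) ℂ),
        V = t * (a ⊗ₖ b)) (c : QubitCircuit n) :
    ∃ q ∈ twoQubitProducts n T (QubitCircuit.twoQubitCount c),
      ∃ a : Fin n → Matrix (Fin 2) (Fin 2) ℂ,
        (∀ i, a i ∈ unitary (Matrix (Fin 2) (Fin 2) ℂ)) ∧
          QubitCircuit.toMatrix c = q * tensorMatrix a := by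
  induction c with
  | nil => exact ⟨1, rfl, 1, fun _ => one_mem _, by rw [tensorMatrix_one, mul_one]; rfl⟩
  | cons g c ih =>
    obtain ⟨q, hq, a, ha, h⟩ := ih
    cases g with
    | one i u =>
      refine ⟨q, hq, a * Function.update (1 : Fin n → Matrix (Fin 2) (Fin 2) ℂ) i u, fun l => ?_, ?_⟩
      · refine mul_mem (ha l) ?_
        by_cases hl : l = i
        · subst hl
          simp
        · rw [Function.update_of_ne hl]
          exact one_mem _
      · rw [← tensorMatrix_mul, ← mul_assoc, ← h, ← oneQubitGate_toMatrix]
        rfl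
    | two i j hij V =>
      obtain ⟨t, ht, b, hb, b', hb', hV⟩ := hT ((a i ⊗ₖ a j) * V)
        (mul_mem (Matrix.kronecker_mem_unitary (ha i) (ha j)) V.2)
      refine ⟨q * twoQubitMatrix i j t, Set.mem_iUnion.2 ⟨(i, j), (q, t), ⟨hq, ht⟩, rfl⟩,
        Function.update (Function.update a i b) j b', fun l => ?_, ?_⟩
      · by_cases hj : l = j
        · subst hj
          simpa using hb'
        · by_cases hi : l = i
          · subst hi
            simpa [hj] using hb
          · simpa [hi, hj] using ha l
      · rw [mul_assoc, ← tensorMatrix_mul_twoQubitMatrix hij a hV, ← mul_assoc, ← h]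
        rfl

theorem ae_requiresTwoQubitGates (n : ℕ) : ∀ᵐ U ∂(qubitHaar n),
    RequiresTwoQubitGates U ⌈((4 : ℚ) ^ n - 3 * (n : ℚ) - 1) / 9⌉ := by
  obtain ⟨T, hT, -, hTs⟩ := exists_slice_two_qubit
  have key : ∀ k : ℕ, 9 * k + 3 * n + 1 < 4 ^ n → ∀ᵐ U ∂(qubitHaar n),
      ¬ ∃ c : QubitCircuit n, QubitCircuit.twoQubitCount c = k ∧ QubitCircuit.Implements c U := by
    intro k hk
    have hS := ((countablyParametrized_twoQubitProducts n hT k).prod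
      (countablyParametrized_tensorMatrix n)).image (contDiff_fst.mul contDiff_snd)
    have hd : k * 9 + (1 + n * 3) < finrank ℂ (Matrix (QubitBasis n) (QubitBasis n) ℂ) := by
      have : (4 : ℕ) ^ n = 2 ^ n * 2 ^ n := by
        rw [← mul_pow]; norm_num
      simp only [Module.finrank_matrix, Module.finrank_self, Fintype.card_fun, Fintype.card_fin,
        mul_one]
      omega
    have h0 := hS.measure_unitary_eq_zero (qubitHaar n) hd
    refine measure_mono_null ?_ h0
    intro U hU
    obtain ⟨c, rfl, hc⟩ := not_not.1 hU
    obtain ⟨q, hq, a, ha, h⟩ := QubitCircuit.exists_toMatrix_eq hTs c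
    exact ⟨(q, tensorMatrix a), ⟨hq, a, ha, rfl⟩, h.symm.trans hc⟩
  have hall : ∀ᵐ U ∂(qubitHaar n), ∀ k : ℕ, 9 * k + 3 * n + 1 < 4 ^ n →
      ¬ ∃ c : QubitCircuit n, QubitCircuit.twoQubitCount c = k ∧ QubitCircuit.Implements c U := by
    refine ae_all_iff.2 fun k => ?_
    by_cases hk : 9 * k + 3 * n + 1 < 4 ^ n
    · filter_upwards [key k hk] with U hU _ using hU
    · exact Filter.Eventually.of_forall fun U h => absurd h hk
  filter_upwards [hall] with U hU c hc
  by_contra hlt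
  -- An integer lies below `⌈x⌉` exactly when it lies below `x`, so failure of the bound is the
  -- strict inequality `9k + 3n + 1 < 4^n`.
  rw [not_le, Int.lt_ceil, lt_div_iff₀ (by norm_num)] at hlt
  refine hU (QubitCircuit.twoQubitCount c) ?_ ⟨c, rfl, hc⟩
  have : (9 * (QubitCircuit.twoQubitCount c : ℚ) + 3 * n + 1) < 4 ^ n := by
    push_cast at hlt
    linarith
  exact_mod_cast this

end Circuits

theorem theorem3p1 :
    (∀ n : ℕ, ∀ᵐ U ∂(qubitHaar n),
      RequiresTwoQubitGates U ⌈((4 : ℚ) ^ n - 3 * (n : ℚ) - 1) / 9⌉) ∧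
    (∀ᵐ U ∂(qubitHaar 3), RequiresTwoQubitGates U 6) := by
  refine ⟨ae_requiresTwoQubitGates, ?_⟩
  have h := ae_requiresTwoQubitGates 3
  have h6 : ⌈((4 : ℚ) ^ 3 - 3 * ((3 : ℕ) : ℚ) - 1) / 9⌉ = 6 := by norm_num
  rwa [h6] at h
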